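/- Let $0\le\alpha<\beta$ be real numbers and, for $n\ge 1$, put $$\lambda_n=\frac{(n+\beta+\alpha-1)(n+\beta-\alpha-1)}{2\left(n+\beta-\frac12\right)}.$$ Let $\phi_n$ be the real polynomials with $\phi_0(x)=1$, $\phi_1(x)=\sqrt{2/\lambda_1}\,x$ and $$x\,\phi_n(x)=\sqrt{\frac{\lambda_{n+1}}{2}}\,\phi_{n+1}(x)+\sqrt{\frac{\lambda_n}{2}}\,\phi_{n-1}(x),\qquad n\ge 1,$$ and for $n\ge 0$ and real $m>0$ let $\Phi_{n,m}(t)=\phi_n(\sqrt m\,t)$. Then $\Phi_{n,m}$ has degree $n$ and has $n$ real zeros $x_1,\dots,x_n$, counted with multiplicity. For $n\ge1$ let $\nu(\Phi_{n,m})=\frac1n\sum_{j=1}^n\delta_{x_j}$ be its normalized zero counting measure, where $\delta_x$ is the Dirac point mass at $x$. For every $c>0$, as $n\to\infty$ and $n/m\to c$, the measures $\nu(\Phi_{n,m})$ converge weakly (that is, against bounded continuous functions on $\mathbb R$) to the probability measure $\nu_c$ on $\mathbb R$ with density $$\frac{d\nu_c}{dt}=\begin{cases}\dfrac{2}{\pi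 c}\sqrt{c-t^2}, & t\in(-\sqrt c,\sqrt c),\\[1ex] 0, & \text{elsewhere.}\end{cases}$$ In particular, the limit $\nu_c$ does not depend on $\alpha$ and $\beta$. -/

import Mathlib

open scoped Polynomial NNReal
open MeasureTheory

noncomputable section

/-- The recurrence coefficient `λ_n(α, β)`, used for `n ≥ 1`. -/
def recLambda (α β : ℝ) (n : ℕ) : ℝ :=
  ((n + β + α - 1) * (n + β - α - 1)) / (2 * (n + β - 1 / 2))

/-- The polynomials `φ_n` with `φ_0 = 1`, `φ_1 = √(2 / λ_1) x` and
`x φ_n = √(λ_{n+1} / 2) φ_{n+1} + √(λ_n / 2) φ_{n-1}` for `n ≥ 1`, solved for `φ_{n+1}`. -/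
def phi (α β : ℝ) : ℕ → ℝ[X]
  | 0 => 1
  | 1 => Polynomial.C (Real.sqrt (2 / recLambda α β 1)) * Polynomial.X
  | n + 2 =>
      Polynomial.C (Real.sqrt (2 / recLambda α β (n + 2))) *
        (Polynomial.X * phi α β (n + 1)
          - Polynomial.C (Real.sqrt (recLambda α β (n + 1) / 2)) * phi α β n)

/-- The rescaled polynomial `Φ_{n,m}(t) = φ_n(√m t)`. -/
def rescaledPhi (α β : ℝ) (n : ℕ) (m : ℝ) : ℝ[X] :=
  (phi α β n).comp (Polynomial.C (Real.sqrt m) * Polynomial.X)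

/-- The Dirac point mass at `x`, as a finite measure. -/
def pointMass (x : ℝ) : FiniteMeasure ℝ := ⟨Measure.dirac x, inferInstance⟩

/-- The normalized zero counting measure `(1 / n) ∑ δ_{x_j}` of a real polynomial of degree `n`,
the sum running over its real zeros, with multiplicity. -/
def zeroCountingMeasure (p : ℝ[X]) : FiniteMeasure ℝ :=
  (p.natDegree : ℝ≥0)⁻¹ • (p.roots.map pointMass).sum

/-- The density `2 / (π c) √(c - t²)` on `(-√c, √c)`, and `0` elsewhere. -/
def limitDensity (c t : ℝ) : ℝ :=
  open Classical in
  if t ∈ Set.Ioo (-Real.sqrt c) (Real.sqrt c) then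
    2 / (Real.pi * c) * Real.sqrt (c - t ^ 2)
  else 0

end

/-!
The proof is the method of moments, applied to Jacobi matrices.

Put `b n = √(λ_n / 2)` for `n ≥ 1` and `b 0 = 0`. The recurrence says that `φ_n` is, up to a factor,
the characteristic polynomial of the `n × n` Jacobi matrix `J_n` with off-diagonal entries
`b 1, …, b (n - 1)`. No determinant is needed for this: an eigenvector of `J_n` for `x` must be a
multiple of `(φ_0(x), …, φ_{n-1}(x))`, so the eigenvalues are simple and are zeros of `φ_n`, and
there are `n` of them (`IsJacobiRecurrence.roots_eq`). Hence all zeros are real, and the `k`-th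
moment of `ν(Φ_{n,m})` is `tr J_n ^ k / (n √m ^ k)`.

Diagonal entries of `J_n ^ k` away from the last `k` sites are weights of closed walks of length `k`
on `ℕ` (`jacobiMatrix_pow_apply`). Since `b n ~ √n / 2`, the weight of those starting at `i` is
asymptotic to `√i ^ k` times the return probability `P_k` of the simple symmetric random walk,
written as the Fourier coefficient `(1 / π) ∫_0^π cos ^ k` (`tendsto_walkWeight`). This asymptotic
is all that survives of `α` and `β`. Summing over `i` gives
`tr J_n ^ k / (n √n ^ k) → P_k / (k / 2 + 1)` (`tendsto_trace_jacobiMatrix_pow`), and with `n / m → c`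
the `k`-th moments tend to `√c ^ k P_k / (k / 2 + 1)`. The substitution `t = √c cos θ` shows that
these are the moments of the semicircle law `ν_c` (`integral_limitDensity_mul_pow`).

Absolute column sums bound the eigenvalues of `J_n` by a constant times `√n`, so the rescaled zeros
stay in a fixed interval, and there convergence of moments implies weak convergence by Weierstrass
approximation (`tendsto_integral_of_tendsto_moments`).
-/

open MeasureTheory Filter Topology Polynomial

/-! ### Jacobi matrices and their eigenvalues -/

/-- The trace of a power of a Hermitian matrix is the corresponding power sum of its
eigenvalues. -/
lemma Matrix.IsHermitian.trace_pow_eq_sum {ι : Type*} [Fintype ι] [DecidableEq ι]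
    {A : Matrix ι ι ℝ} (hA : A.IsHermitian) (k : ℕ) :
    (A ^ k).trace = ∑ i, hA.eigenvalues i ^ k := by
  conv_lhs => rw [hA.spectral_theorem, ← map_pow, Unitary.conjStarAlgAut_apply,
    Matrix.trace_mul_cycle, Unitary.coe_star_mul_self, Matrix.one_mul, Matrix.diagonal_pow,
    Matrix.trace_diagonal]
  simp

lemma Matrix.IsHermitian.eigenvectorBasis_ne_zero {ι : Type*} [Fintype ι] [DecidableEq ι]
    {A : Matrix ι ι ℝ} (hA : A.IsHermitian) (i : ι) : (hA.eigenvectorBasis i : ι → ℝ) ≠ 0 :=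
  fun h0 => hA.eigenvectorBasis.toBasis.ne_zero i (by ext l; simpa using congrFun h0 l)

/-- The `n × n` Jacobi matrix with zero diagonal whose off-diagonal entry in the rows and columns
`i`, `i + 1` (counted from `0`) is `b (i + 1)`. The value `b 0` does not occur. -/
def jacobiMatrix (b : ℕ → ℝ) (n : ℕ) : Matrix (Fin n) (Fin n) ℝ :=
  Matrix.of fun i j =>
    if (i : ℕ) + 1 = j then b j else if (j : ℕ) + 1 = i then b i else 0

lemma jacobiMatrix_symm (b : ℕ → ℝ) (n : ℕ) (i j : Fin n) :
    jacobiMatrix b n i j = jacobiMatrix b n j i := by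
  simp only [jacobiMatrix, Matrix.of_apply]
  split_ifs <;> first | rfl | omega

lemma jacobiMatrix_isHermitian (b : ℕ → ℝ) (n : ℕ) : (jacobiMatrix b n).IsHermitian := by
  ext i j
  simpa using jacobiMatrix_symm b n j i

/-- A row vector times a column of the Jacobi matrix, the vector being given by a sequence that
vanishes at `n`. The convention `b 0 = 0` makes the truncated index `j - 1` harmless. -/
lemma sum_mul_jacobiMatrix {b : ℕ → ℝ} (hb0 : b 0 = 0) {n : ℕ} {u : ℕ → ℝ} (hu : u n = 0)
    (j : Fin n) :
    ∑ l : Fin n, u l * jacobiMatrix b n l j = b j * u (j - 1) + b (j + 1) * u (j + 1) := by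
  obtain ⟨j, hj⟩ := j
  simp only [jacobiMatrix, Matrix.of_apply]
  rw [Fin.sum_univ_eq_sum_range
    (fun l => u l * if l + 1 = j then b j else if j + 1 = l then b l else 0)]
  have h : ∀ l ∈ Finset.range n, (u l * if l + 1 = j then b j else if j + 1 = l then b l else 0) =
      (if l = j - 1 then b j * u (j - 1) else 0) +
        (if l = j + 1 then b (j + 1) * u (j + 1) else 0) := by
    intro l _
    rcases Nat.eq_zero_or_pos j with rfl | hpos
    · by_cases h1 : l = 1 <;> simp [h1, hb0, eq_comm, mul_comm]
    · by_cases h1 : l + 1 = j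
      · rw [if_pos h1, if_pos (by omega), if_neg (by omega), add_zero, mul_comm]
        congr 2; omega
      · by_cases h2 : j + 1 = l
        · rw [if_neg h1, if_pos h2, if_neg (by omega), if_pos (by omega), zero_add, h2, mul_comm]
        · rw [if_neg h1, if_neg h2, if_neg (by omega), if_neg (by omega)]; simp
  rw [Finset.sum_congr rfl h, Finset.sum_add_distrib, Finset.sum_ite_eq', Finset.sum_ite_eq',
    if_pos (Finset.mem_range.2 (by omega))]
  by_cases h3 : j + 1 < n
  · rw [if_pos (Finset.mem_range.2 h3)]
  · rw [if_neg (by simpa using h3), show j + 1 = n by omega, hu, mul_zero]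

/-- If all off-diagonal entries are at most `B`, the absolute column sums are at most `2 * B`. -/
lemma sum_abs_jacobiMatrix_le {b : ℕ → ℝ} (hb0 : b 0 = 0) (hb : ∀ i, 0 ≤ b i) {n : ℕ} {B : ℝ}
    (hB : ∀ i ≤ n, b i ≤ B) (j : Fin n) : ∑ l : Fin n, |jacobiMatrix b n l j| ≤ 2 * B := by
  have h0 : 0 ≤ B := (hb 0).trans (hB 0 (Nat.zero_le _))
  have key := sum_mul_jacobiMatrix hb0 (u := fun l => if l < n then 1 else 0) (by simp) j
  have : ∑ l : Fin n, |jacobiMatrix b n l j| =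
      ∑ l : Fin n, (if (l : ℕ) < n then 1 else 0) * jacobiMatrix b n l j := by
    refine Finset.sum_congr rfl fun l _ => ?_
    rw [if_pos l.2, one_mul, abs_of_nonneg]
    simp only [jacobiMatrix, Matrix.of_apply]
    split_ifs <;> first | exact hb _ | exact le_rfl
  rw [this, key]
  have h1 := hB j j.2.le
  have h2 := hB (j + 1) j.2
  split_ifs <;> linarith

lemma abs_jacobiMatrix_pow_le {b : ℕ → ℝ} (hb0 : b 0 = 0) (hb : ∀ i, 0 ≤ b i) {n : ℕ} {B : ℝ}
    (hB : ∀ i ≤ n, b i ≤ B) (k : ℕ) (i j : Fin n) :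
    |(jacobiMatrix b n ^ k) i j| ≤ (2 * B) ^ k := by
  have h0 : 0 ≤ B := (hb 0).trans (hB 0 (Nat.zero_le _))
  induction k generalizing j with
  | zero =>
    rw [pow_zero, pow_zero, Matrix.one_apply]
    split_ifs <;> simp
  | succ k ih =>
    rw [pow_succ, pow_succ, Matrix.mul_apply]
    calc |∑ l, (jacobiMatrix b n ^ k) i l * jacobiMatrix b n l j|
        ≤ ∑ l, |(jacobiMatrix b n ^ k) i l * jacobiMatrix b n l j| :=
          Finset.abs_sum_le_sum_abs _ _
      _ ≤ ∑ l, (2 * B) ^ k * |jacobiMatrix b n l j| := by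
          refine Finset.sum_le_sum fun l _ => ?_
          rw [abs_mul]
          exact mul_le_mul_of_nonneg_right (ih l) (abs_nonneg _)
      _ ≤ (2 * B) ^ k * (2 * B) := by
          rw [← Finset.mul_sum]
          exact mul_le_mul_of_nonneg_left (sum_abs_jacobiMatrix_le hb0 hb hB j) (by positivity)

lemma abs_eigenvalue_jacobiMatrix_le {b : ℕ → ℝ} (hb0 : b 0 = 0) (hb : ∀ i, 0 ≤ b i) {n : ℕ}
    {B : ℝ} (hB : ∀ i ≤ n, b i ≤ B) {x : ℝ} {v : Fin n → ℝ} (hv : v ≠ 0)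
    (hx : Matrix.mulVec (jacobiMatrix b n) v = x • v) : |x| ≤ 2 * B := by
  obtain ⟨i₀, hi₀⟩ := Function.ne_iff.1 hv
  -- compare the two sides at an entry of `v` of largest absolute value
  obtain ⟨j, -, hj⟩ := Finset.exists_max_image Finset.univ (fun i => |v i|) ⟨i₀, Finset.mem_univ _⟩
  have hpos : 0 < |v j| := (abs_pos.2 hi₀).trans_le (hj i₀ (Finset.mem_univ _))
  refine le_of_mul_le_mul_right ?_ hpos
  calc |x| * |v j| = |∑ l, jacobiMatrix b n j l * v l| := by
        rw [← abs_mul]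
        exact congrArg abs (congrFun hx j).symm
    _ ≤ ∑ l, |jacobiMatrix b n j l * v l| := Finset.abs_sum_le_sum_abs _ _
    _ ≤ ∑ l, |jacobiMatrix b n l j| * |v j| := by
        refine Finset.sum_le_sum fun l _ => ?_
        rw [abs_mul, jacobiMatrix_symm]
        exact mul_le_mul_of_nonneg_left (hj l (Finset.mem_univ _)) (abs_nonneg _)
    _ ≤ 2 * B * |v j| := by
        rw [← Finset.sum_mul]
        exact mul_le_mul_of_nonneg_right (sum_abs_jacobiMatrix_le hb0 hb hB j) hpos.le

/-- The three-term recurrence `x p_n = b_{n+1} p_{n+1} + b_n p_{n-1}` with `p_0 = 1`; for `n = 0`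
the last term drops out in the presence of `b 0 = 0`. -/
structure IsJacobiRecurrence (b : ℕ → ℝ) (p : ℕ → ℝ[X]) : Prop where
  zero_coeff : b 0 = 0
  pos : ∀ i, 0 < b (i + 1)
  init : p 0 = 1
  step : ∀ n, X * p n = C (b (n + 1)) * p (n + 1) + C (b n) * p (n - 1)

namespace IsJacobiRecurrence

variable {b : ℕ → ℝ} {p : ℕ → ℝ[X]}

lemma nonneg (h : IsJacobiRecurrence b p) (i : ℕ) : 0 ≤ b i := by
  cases i with
  | zero => exact h.zero_coeff.ge
  | succ i => exact (h.pos i).le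

lemma natDegree_eq (h : IsJacobiRecurrence b p) (n : ℕ) : (p n).natDegree = n := by
  suffices ∀ n, (p n).degree = n ∧ (p (n + 1)).degree = (n + 1 : ℕ) from
    natDegree_eq_of_degree_eq_some (this n).1
  have key : ∀ n, (p n).degree = n → (p (n - 1)).degree ≤ n →
      (p (n + 1)).degree = (n + 1 : ℕ) := by
    intro n h1 h2
    have e : C (b (n + 1)) * p (n + 1) = X * p n - C (b n) * p (n - 1) := by rw [h.step n]; ring
    have h3 : (X * p n).degree = ((n + 1 : ℕ) : WithBot ℕ) := by
      rw [degree_mul, degree_X, h1, add_comm]; rfl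
    have h4 : (C (b n) * p (n - 1)).degree < (X * p n).degree := by
      rw [h3]
      refine ((degree_mul_le _ _).trans (add_le_of_nonpos_left degree_C_le)).trans_lt
        (h2.trans_lt ?_)
      exact_mod_cast Nat.lt_succ_self n
    rw [← degree_C_mul (p := p (n + 1)) (h.pos n).ne', e, degree_sub_eq_left_of_degree_lt h4, h3]
  intro n
  induction n with
  | zero =>
    have h0 : (p 0).degree = (0 : ℕ) := by rw [h.init]; simp
    exact ⟨h0, key 0 h0 h0.le⟩
  | succ n ih => exact ⟨ih.2, key (n + 1) ih.2 (by
      rw [Nat.add_sub_cancel, ih.1]; exact_mod_cast Nat.le_succ n)⟩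

/-- An eigenvector of the Jacobi matrix is a multiple of `(p_0(x), …, p_{n-1}(x))`, and continuing
the recurrence one step further forces `p_n(x) = 0`. -/
lemma eigenvector_eq (h : IsJacobiRecurrence b p) {n : ℕ} {x : ℝ} {v : Fin n → ℝ} (hv : v ≠ 0)
    (hx : Matrix.mulVec (jacobiMatrix b n) v = x • v) :
    (p n).eval x = 0 ∧ ∃ a : ℝ, a ≠ 0 ∧ ∀ i : Fin n, v i = a * (p i).eval x := by
  set u : ℕ → ℝ := fun i => if hi : i < n then v ⟨i, hi⟩ else 0 with hu
  have huv : ∀ i : Fin n, u i = v i := fun i => by simp [hu]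
  have hun : u n = 0 := by simp [hu]
  have hrec : ∀ j < n, b j * u (j - 1) + b (j + 1) * u (j + 1) = x * u j := by
    intro j hj
    rw [← sum_mul_jacobiMatrix h.zero_coeff hun ⟨j, hj⟩, huv ⟨j, hj⟩]
    have e := congrFun hx ⟨j, hj⟩
    rw [Pi.smul_apply, smul_eq_mul] at e
    rw [← e]
    refine Finset.sum_congr rfl fun l _ => ?_
    rw [huv, jacobiMatrix_symm, mul_comm]
  have hp : ∀ j, x * (p j).eval x =
      b (j + 1) * (p (j + 1)).eval x + b j * (p (j - 1)).eval x := by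
    intro j
    simpa using congrArg (eval x) (h.step j)
  have hstep : ∀ j < n, u j = u 0 * (p j).eval x → u (j - 1) = u 0 * (p (j - 1)).eval x →
      u (j + 1) = u 0 * (p (j + 1)).eval x := by
    intro j hj h1 h2
    have e := hrec j hj
    rw [h1, h2] at e
    refine mul_left_cancel₀ (h.pos j).ne' ?_
    linear_combination e + u 0 * hp j
  have h0 : u 0 = u 0 * (p 0).eval x := by simp [h.init]
  have hmain : ∀ j ≤ n, u j = u 0 * (p j).eval x ∧ u (j - 1) = u 0 * (p (j - 1)).eval x := by
    intro j hj
    induction j with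
    | zero => exact ⟨h0, h0⟩
    | succ j ih =>
      obtain ⟨h1, h2⟩ := ih (by omega)
      exact ⟨hstep j (by omega) h1 h2, h1⟩
  have hu0 : u 0 ≠ 0 := by
    intro h0
    refine hv (funext fun i => ?_)
    rw [← huv, (hmain i i.2.le).1, h0, zero_mul, Pi.zero_apply]
  refine ⟨?_, u 0, hu0, fun i => by rw [← huv]; exact (hmain i i.2.le).1⟩
  have := (hmain n le_rfl).1
  rw [hun] at this
  exact (mul_eq_zero.1 this.symm).resolve_left hu0

/-- The eigenvalues of the Jacobi matrix are simple: eigenvectors with the same eigenvalue are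
proportional, whereas the eigenvector basis is orthonormal. -/
lemma eigenvalues_injective (h : IsJacobiRecurrence b p) (n : ℕ) :
    Function.Injective (jacobiMatrix_isHermitian b n).eigenvalues := by
  set hA := jacobiMatrix_isHermitian b n
  intro i j hij
  by_contra hne
  obtain ⟨-, a, ha, h1⟩ := h.eigenvector_eq (hA.eigenvectorBasis_ne_zero i)
    (hA.mulVec_eigenvectorBasis i)
  obtain ⟨-, c, hc, h2⟩ := h.eigenvector_eq (hA.eigenvectorBasis_ne_zero j)
    (hA.mulVec_eigenvectorBasis j)
  have hprop : c • hA.eigenvectorBasis i = a • hA.eigenvectorBasis j := by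
    ext l
    simp only [PiLp.smul_apply, smul_eq_mul]
    rw [h1 l, h2 l, hij]
    ring
  have horth := hA.eigenvectorBasis.orthonormal
  have h3 : inner ℝ (hA.eigenvectorBasis i) (c • hA.eigenvectorBasis i) = c := by
    rw [inner_smul_right, real_inner_self_eq_norm_sq, horth.1]; simp
  rw [hprop, inner_smul_right, horth.2 hne, mul_zero] at h3
  exact hc h3.symm

lemma roots_eq (h : IsJacobiRecurrence b p) (n : ℕ) :
    (p n).roots = Finset.univ.val.map (jacobiMatrix_isHermitian b n).eigenvalues := by
  set hA := jacobiMatrix_isHermitian b n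
  have hp0 : p n ≠ 0 := by
    intro h0
    rcases Nat.eq_zero_or_pos n with rfl | hn
    · rw [h.init] at h0; exact one_ne_zero h0
    · have := h.natDegree_eq n
      rw [h0, natDegree_zero] at this
      omega
  refine (Multiset.eq_of_le_of_card_le ?_ ?_).symm
  · refine Multiset.le_iff_subset ?_ |>.2 ?_
    · exact (Multiset.nodup_map_iff_of_injective (h.eigenvalues_injective n)).2
        Finset.univ.nodup
    · intro x hx
      obtain ⟨i, -, rfl⟩ := Multiset.mem_map.1 hx
      exact (mem_roots hp0).2 (h.eigenvector_eq (hA.eigenvectorBasis_ne_zero i)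
        (hA.mulVec_eigenvectorBasis i)).1
  · refine (card_roots' _).trans ?_
    rw [h.natDegree_eq n]
    simp

end IsJacobiRecurrence

/-! ### Walk weights and their asymptotics -/

/-- The total weight of the walks of length `k` on `ℕ` with steps `±1` from `i` to `i + d`, where
the edge between `j - 1` and `j` has weight `b j`. The displacement `d` is an integer; edges with
`j ≤ 0` get the weight `b 0`, which is `0` where this is used. -/
def walkWeight (b : ℕ → ℝ) : ℕ → ℕ → ℤ → ℝ
  | 0, _, d => if d = 0 then 1 else 0
  | k + 1, i, d =>
      b (i + d).toNat * walkWeight b k i (d - 1) +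
        b (i + d + 1).toNat * walkWeight b k i (d + 1)

lemma walkWeight_eq_zero (b : ℕ → ℝ) {k : ℕ} (i : ℕ) {d : ℤ} (hd : (k : ℤ) < |d|) :
    walkWeight b k i d = 0 := by
  induction k generalizing d with
  | zero => exact if_neg (by rintro rfl; simp at hd)
  | succ k ih =>
    have h1 : (k : ℤ) < |d - 1| := by push_cast at hd; grind
    have h2 : (k : ℤ) < |d + 1| := by push_cast at hd; grind
    rw [walkWeight, ih h1, ih h2, mul_zero, mul_zero, add_zero]

/-- Walks too short to reach the end of the truncation do not see it. -/
lemma jacobiMatrix_pow_apply {b : ℕ → ℝ} (hb0 : b 0 = 0) {n k : ℕ} {i : Fin n} (hi : i + k < n)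
    (j : Fin n) : (jacobiMatrix b n ^ k) i j = walkWeight b k i ((j : ℤ) - i) := by
  induction k generalizing j with
  | zero =>
    rw [pow_zero, Matrix.one_apply, walkWeight]
    refine if_congr ?_ rfl rfl
    rw [Fin.ext_iff]
    omega
  | succ k ih =>
    rw [pow_succ, Matrix.mul_apply]
    have hu : walkWeight b k i (((n : ℕ) : ℤ) - i) = 0 :=
      walkWeight_eq_zero b i (by rw [abs_of_nonneg] <;> omega)
    have key := sum_mul_jacobiMatrix hb0 (u := fun l => walkWeight b k i ((l : ℤ) - i)) hu j
    simp only [ih (by omega)]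
    rw [key, walkWeight]
    have e1 : ((i : ℕ) + ((j : ℤ) - (i : ℕ))).toNat = j := by omega
    have e2 : ((i : ℕ) + ((j : ℤ) - (i : ℕ)) + 1).toNat = (j : ℕ) + 1 := by omega
    rw [e1, e2]
    congr 1
    · rcases Nat.eq_zero_or_pos (j : ℕ) with h0 | h0
      · rw [h0, hb0, zero_mul, zero_mul]
      · congr 2; omega
    · congr 2; push_cast; ring

/-- The probability that a simple symmetric random walk on `ℤ` is at `d` at time `k`, as a Fourier
coefficient of `cos ^ k`. -/
noncomputable def cosCoeff (k : ℕ) (d : ℤ) : ℝ :=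
  (1 / Real.pi) * ∫ θ in (0 : ℝ)..Real.pi, Real.cos θ ^ k * Real.cos (d * θ)

lemma cosCoeff_zero (d : ℤ) : cosCoeff 0 d = if d = 0 then 1 else 0 := by
  rw [cosCoeff]
  split_ifs with h
  · simp [h, Real.pi_ne_zero]
  · have hd : (d : ℝ) ≠ 0 := by exact_mod_cast h
    simp [intervalIntegral.integral_comp_mul_left _ hd, integral_cos, Real.sin_int_mul_pi]

lemma cosCoeff_succ (k : ℕ) (d : ℤ) :
    cosCoeff (k + 1) d = 1 / 2 * cosCoeff k (d - 1) + 1 / 2 * cosCoeff k (d + 1) := by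
  have hi : ∀ e : ℤ, IntervalIntegrable (fun θ => Real.cos θ ^ k * Real.cos (e * θ)) volume 0
      Real.pi := fun e => Continuous.intervalIntegrable (by fun_prop) _ _
  have h : ∫ θ in (0 : ℝ)..Real.pi, Real.cos θ ^ (k + 1) * Real.cos (d * θ) =
      1 / 2 * ((∫ θ in (0 : ℝ)..Real.pi, Real.cos θ ^ k * Real.cos ((d - 1 : ℤ) * θ)) +
        ∫ θ in (0 : ℝ)..Real.pi, Real.cos θ ^ k * Real.cos ((d + 1 : ℤ) * θ)) := by
    rw [← intervalIntegral.integral_add (hi _) (hi _), ← intervalIntegral.integral_const_mul]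
    refine intervalIntegral.integral_congr fun θ _ => ?_
    push_cast
    simp only [sub_mul, add_mul, one_mul, Real.cos_sub, Real.cos_add]
    ring
  simp only [cosCoeff, h]
  ring

/-- If `b n ~ √n / 2`, then far from the origin the walk weights are those of the simple symmetric
random walk, up to the factor `√i ^ k`. -/
lemma tendsto_walkWeight {b : ℕ → ℝ}
    (hb : Tendsto (fun n : ℕ => b n / √n) atTop (𝓝 (1 / 2))) (k : ℕ) (d : ℤ) :
    Tendsto (fun i : ℕ => walkWeight b k i d / √i ^ k) atTop (𝓝 (cosCoeff k d)) := by
  have hshift : ∀ e : ℤ, Tendsto (fun i : ℕ => b (i + e).toNat / √i) atTop (𝓝 (1 / 2)) := by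
    intro e
    have h1 : Tendsto (fun i : ℕ => ((i : ℤ) + e).toNat) atTop atTop :=
      tendsto_atTop_atTop.2 fun N => ⟨N + e.natAbs, fun i hi => by omega⟩
    have h2 : Tendsto (fun i : ℕ => √(((((i : ℤ) + e).toNat : ℕ) : ℝ) / i)) atTop (𝓝 1) := by
      rw [← Real.sqrt_one]
      refine (Real.continuous_sqrt.tendsto _).comp ?_
      have h3 : Tendsto (fun i : ℕ => 1 + (e : ℝ) / i) atTop (𝓝 1) := by
        simpa using (tendsto_const_div_atTop_nhds_zero_nat (e : ℝ)).const_add 1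
      refine h3.congr' ?_
      filter_upwards [eventually_gt_atTop e.natAbs] with i hi
      have h4 : ((((i : ℤ) + e).toNat : ℕ) : ℝ) = i + e := by
        have : ((((i : ℤ) + e).toNat : ℕ) : ℤ) = i + e := Int.toNat_of_nonneg (by omega)
        exact_mod_cast this
      have h5 : (i : ℝ) ≠ 0 := by exact_mod_cast (by omega : i ≠ 0)
      rw [h4]
      field_simp
    have h6 := (hb.comp h1).mul h2
    rw [mul_one] at h6
    refine h6.congr' ?_
    filter_upwards [eventually_gt_atTop e.natAbs] with i hi
    have h7 : √(((((i : ℤ) + e).toNat : ℕ) : ℝ)) ≠ 0 := by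
      refine (Real.sqrt_pos.2 ?_).ne'
      exact_mod_cast (by omega : 0 < ((i : ℤ) + e).toNat)
    rw [Function.comp_apply, Real.sqrt_div (Nat.cast_nonneg _)]
    field_simp
  induction k generalizing d with
  | zero => simp [walkWeight, cosCoeff_zero]
  | succ k ih =>
    rw [cosCoeff_succ]
    refine (((hshift d).mul (ih (d - 1))).add ((hshift (d + 1)).mul (ih (d + 1)))).congr fun i => ?_
    rw [walkWeight, pow_succ, add_div, add_assoc]
    simp only [div_eq_mul_inv, mul_inv]
    ring

/-! ### Averaged traces of powers -/

lemma tendsto_sum_sqrt_pow (k : ℕ) :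
    Tendsto (fun n : ℕ => (∑ i ∈ Finset.range n, √(i : ℝ) ^ k) / (n * √n ^ k)) atTop
      (𝓝 (1 / ((k : ℝ) / 2 + 1))) := by
  set a : ℝ := (k : ℝ) / 2 with ha
  have ha0 : 0 ≤ a := by positivity
  have hpow : ∀ x : ℝ, 0 ≤ x → √x ^ k = x ^ a := by
    intro x hx
    rw [Real.sqrt_eq_rpow, ← Real.rpow_natCast, ← Real.rpow_mul hx, ha]
    congr 1; ring
  have hmono : ∀ x y : ℝ, 0 ≤ x → MonotoneOn (fun t : ℝ => t ^ a) (Set.Icc x y) :=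
    fun x y hx s hs t _ hst => Real.rpow_le_rpow (hx.trans hs.1) hst ha0
  have hint : ∀ n : ℕ, ∫ t in (0 : ℝ)..n, t ^ a = (n : ℝ) ^ (a + 1) / (a + 1) := by
    intro n
    rw [integral_rpow (Or.inl (by linarith)), Real.zero_rpow (by linarith), sub_zero]
  have hupper : ∀ n : ℕ, ∑ i ∈ Finset.range n, √(i : ℝ) ^ k ≤ (n : ℝ) ^ (a + 1) / (a + 1) := by
    intro n
    rw [← hint]
    have := MonotoneOn.sum_le_integral (x₀ := 0) (a := n) (hmono 0 _ le_rfl)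
    simp only [zero_add] at this
    refine le_trans (le_of_eq ?_) this
    exact Finset.sum_congr rfl fun i _ => hpow _ (Nat.cast_nonneg i)
  have hlower : ∀ n : ℕ, (n : ℝ) ^ (a + 1) / (a + 1) ≤
      ∑ i ∈ Finset.range n, √(i : ℝ) ^ k + (n : ℝ) ^ a := by
    intro n
    rw [← hint]
    have := MonotoneOn.integral_le_sum (x₀ := 0) (a := n) (hmono 0 _ le_rfl)
    simp only [zero_add] at this
    refine this.trans ?_
    have e : ∑ i ∈ Finset.range (n + 1), √(i : ℝ) ^ k =
        ∑ i ∈ Finset.range n, √(i : ℝ) ^ k + (n : ℝ) ^ a := by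
      rw [Finset.sum_range_succ, hpow _ (Nat.cast_nonneg n)]
    rw [← e, Finset.sum_range_succ']
    refine le_trans (le_of_eq ?_) (le_add_of_nonneg_right (by positivity))
    exact Finset.sum_congr rfl fun i _ => (hpow _ (Nat.cast_nonneg _)).symm
  have hlim : Tendsto (fun n : ℕ => 1 / (a + 1) - 1 / (n : ℝ)) atTop (𝓝 (1 / (a + 1))) := by
    simpa using tendsto_one_div_atTop_nhds_zero_nat.const_sub (1 / (a + 1))
  refine tendsto_of_tendsto_of_tendsto_of_le_of_le' hlim tendsto_const_nhds ?_ ?_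
  all_goals
    filter_upwards [eventually_gt_atTop 0] with n hn
    have hn' : (0 : ℝ) < n := by exact_mod_cast hn
    have hd : (n : ℝ) * √(n : ℝ) ^ k = (n : ℝ) ^ (a + 1) := by
      rw [hpow _ hn'.le, Real.rpow_add_one hn'.ne', mul_comm]
    have hq : (n : ℝ) ^ a = (n : ℝ) ^ (a + 1) / n := by
      rw [Real.rpow_add_one hn'.ne']; field_simp
    have hpos : 0 < (n : ℝ) ^ (a + 1) := Real.rpow_pos_of_pos hn' _
    rw [hd]
  · rw [le_div_iff₀ hpos]
    have := hlower n
    rw [hq] at this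
    calc (1 / (a + 1) - 1 / (n : ℝ)) * (n : ℝ) ^ (a + 1)
        = (n : ℝ) ^ (a + 1) / (a + 1) - (n : ℝ) ^ (a + 1) / n := by ring
      _ ≤ _ := by linarith
  · rw [div_le_iff₀ hpos]
    calc _ ≤ _ := hupper n
      _ = _ := by ring

lemma tendsto_sum_walkWeight {b : ℕ → ℝ}
    (hb : Tendsto (fun n : ℕ => b n / √n) atTop (𝓝 (1 / 2))) (k : ℕ) :
    Tendsto (fun n : ℕ => (∑ i ∈ Finset.range n, walkWeight b k i 0) / (n * √n ^ k)) atTop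
      (𝓝 (cosCoeff k 0 / ((k : ℝ) / 2 + 1))) := by
  set P := cosCoeff k 0
  have hS := tendsto_sum_sqrt_pow k
  have hpos : 0 < 1 / ((k : ℝ) / 2 + 1) := by positivity
  have hatTop : Tendsto (fun n : ℕ => ∑ i ∈ Finset.range n, √(i : ℝ) ^ k) atTop atTop := by
    have h1 : Tendsto (fun n : ℕ => (n : ℝ) * √n ^ k) atTop atTop := by
      refine tendsto_atTop_mono' _ ?_ tendsto_natCast_atTop_atTop
      filter_upwards [eventually_ge_atTop 1] with n hn
      have : (1 : ℝ) ≤ √n := Real.one_le_sqrt.2 (by exact_mod_cast hn)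
      exact le_mul_of_one_le_right (Nat.cast_nonneg n) (one_le_pow₀ this)
    refine (hS.pos_mul_atTop hpos h1).congr' ?_
    filter_upwards [eventually_ge_atTop 1] with n hn
    have : (0 : ℝ) < n := by exact_mod_cast hn
    field_simp
  have hlittle : (fun i : ℕ => walkWeight b k i 0 - P * √(i : ℝ) ^ k) =o[atTop]
      fun i : ℕ => √(i : ℝ) ^ k := by
    refine (Asymptotics.isLittleO_iff_tendsto' ?_).2 ?_
    · filter_upwards [eventually_ge_atTop 1] with i hi h0
      have : (0 : ℝ) < i := by exact_mod_cast hi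
      exact absurd h0 (by positivity)
    · have := (tendsto_walkWeight hb k 0).sub_const P
      rw [sub_self] at this
      refine this.congr' ?_
      filter_upwards [eventually_ge_atTop 1] with i hi
      have : (0 : ℝ) < i := by exact_mod_cast hi
      field_simp
  have hsum := (hlittle.sum_range (fun i => by positivity) hatTop).tendsto_div_nhds_zero
  have h2 := (hsum.add_const P).mul hS
  rw [zero_add, mul_one_div] at h2
  refine h2.congr' ?_
  filter_upwards [hatTop.eventually_gt_atTop 0] with n hn
  rw [Finset.sum_sub_distrib, ← Finset.mul_sum]
  field_simp
  ring

/-- Up to boundary terms, of which there are at most `k`, the trace of the `k`-th power of the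
Jacobi matrix is the sum of the weights of closed walks of length `k`. -/
lemma tendsto_trace_jacobiMatrix_pow {b : ℕ → ℝ} (hb0 : b 0 = 0) (hnn : ∀ i, 0 ≤ b i) {M : ℝ}
    (hM : ∀ i : ℕ, b i ≤ M * √i)
    (hb : Tendsto (fun n : ℕ => b n / √n) atTop (𝓝 (1 / 2))) (k : ℕ) :
    Tendsto (fun n : ℕ => (jacobiMatrix b n ^ k).trace / (n * √n ^ k)) atTop
      (𝓝 (cosCoeff k 0 / ((k : ℝ) / 2 + 1))) := by
  have hM0 : 0 ≤ M := by simpa using (hnn 1).trans (hM 1)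
  have hMmono : ∀ N i : ℕ, i ≤ N → b i ≤ M * √N := fun N i hi =>
    (hM i).trans (by gcongr)
  set K : ℝ := (2 * (M * √(k + 1 : ℕ))) ^ k with hK
  have hJ : ∀ n (i : Fin n), |(jacobiMatrix b n ^ k) i i| ≤ K * √n ^ k := by
    intro n i
    refine (abs_jacobiMatrix_pow_le hb0 hnn (hMmono n) k i i).trans ?_
    rw [hK, ← mul_pow]
    have : (1 : ℝ) ≤ √(k + 1 : ℕ) :=
      Real.one_le_sqrt.2 (by push_cast; linarith [k.cast_nonneg (α := ℝ)])
    have h1 : M * √n ≤ M * √(k + 1 : ℕ) * √n := by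
      rw [mul_right_comm]
      exact le_mul_of_one_le_right (by positivity) this
    rw [mul_assoc 2]
    gcongr
  have hw : ∀ n i : ℕ, i < n → |walkWeight b k i 0| ≤ K * √n ^ k := by
    intro n i hin
    -- the weight is a diagonal entry of the truncation at `i + k + 1 ≤ (k + 1) * n`
    have h1 := jacobiMatrix_pow_apply hb0 (n := i + k + 1) (k := k)
      (i := ⟨i, by omega⟩) (by simp) ⟨i, by omega⟩
    rw [sub_self] at h1
    rw [← h1]
    refine (abs_jacobiMatrix_pow_le hb0 hnn (hMmono (i + k + 1)) k _ _).trans ?_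
    rw [hK, ← mul_pow, mul_assoc 2, mul_assoc M, ← Real.sqrt_mul (Nat.cast_nonneg _),
      ← Nat.cast_mul]
    have : i + k + 1 ≤ (k + 1) * n := by nlinarith
    gcongr
  have hdiff : ∀ n : ℕ, |(jacobiMatrix b n ^ k).trace - ∑ i ∈ Finset.range n, walkWeight b k i 0| ≤
      k * (2 * K * √n ^ k) := by
    intro n
    have e : (jacobiMatrix b n ^ k).trace - ∑ i ∈ Finset.range n, walkWeight b k i 0 =
        ∑ i : Fin n, ((jacobiMatrix b n ^ k) i i - walkWeight b k i 0) := by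
      rw [Finset.sum_sub_distrib, Fin.sum_univ_eq_sum_range (fun i => walkWeight b k i 0)]
      rfl
    have hterm : ∀ i : Fin n, |(jacobiMatrix b n ^ k) i i - walkWeight b k i 0| ≤
        if n - k ≤ (i : ℕ) then 2 * K * √n ^ k else 0 := by
      intro i
      split_ifs with hi
      · have h1 := hJ n i
        have h2 := hw n i i.2
        have h3 := abs_sub ((jacobiMatrix b n ^ k) i i) (walkWeight b k i 0)
        linarith
      · have h1 := jacobiMatrix_pow_apply hb0 (k := k) (i := i) (by omega) i
        rw [sub_self] at h1
        rw [h1, sub_self, abs_zero]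
    rw [e]
    refine (Finset.abs_sum_le_sum_abs _ _).trans ((Finset.sum_le_sum fun i _ => hterm i).trans ?_)
    rw [Fin.sum_univ_eq_sum_range (fun i => if n - k ≤ i then 2 * K * √n ^ k else 0),
      ← Finset.sum_filter, Finset.sum_const, nsmul_eq_mul]
    have hsub : (Finset.range n).filter (fun i => n - k ≤ i) ⊆ Finset.Ico (n - k) n := by
      intro i hi
      simp only [Finset.mem_filter, Finset.mem_range] at hi
      exact Finset.mem_Ico.2 ⟨hi.2, hi.1⟩
    have hcard := Finset.card_le_card hsub
    rw [Nat.card_Ico] at hcard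
    gcongr
    omega
  have herr : Tendsto (fun n : ℕ => ((jacobiMatrix b n ^ k).trace -
      ∑ i ∈ Finset.range n, walkWeight b k i 0) / (n * √n ^ k)) atTop (𝓝 0) := by
    refine squeeze_zero_norm' ?_ (tendsto_const_div_atTop_nhds_zero_nat (k * (2 * K)))
    filter_upwards [eventually_gt_atTop 0] with n hn
    have hn' : (0 : ℝ) < n := by exact_mod_cast hn
    have hs : 0 < √(n : ℝ) := Real.sqrt_pos.2 hn'
    rw [Real.norm_eq_abs, abs_div, abs_of_pos (by positivity : 0 < (n : ℝ) * √(n : ℝ) ^ k),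
      div_le_div_iff₀ (by positivity) hn']
    nlinarith [mul_le_mul_of_nonneg_right (hdiff n) hn'.le]
  have := herr.add (tendsto_sum_walkWeight hb k)
  rw [zero_add] at this
  refine this.congr fun n => ?_
  rw [← add_div, sub_add_cancel]

/-! ### The limit measure -/

lemma limitDensity_nonneg {c : ℝ} (hc : 0 < c) (t : ℝ) : 0 ≤ limitDensity c t := by
  unfold limitDensity
  split_ifs
  · have := Real.pi_pos
    positivity
  · exact le_rfl

lemma limitDensity_eq_indicator (c : ℝ) : limitDensity c =
    (Set.Ioo (-√c) √c).indicator fun t => 2 / (Real.pi * c) * √(c - t ^ 2) := by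
  ext t
  by_cases h : t ∈ Set.Ioo (-√c) √c
  · rw [Set.indicator_of_mem h, limitDensity, if_pos h]
  · rw [Set.indicator_of_notMem h, limitDensity, if_neg h]

lemma measurable_limitDensity (c : ℝ) : Measurable (limitDensity c) := by
  rw [limitDensity_eq_indicator]
  exact Measurable.indicator (by fun_prop) measurableSet_Ioo

lemma integrable_limitDensity (c : ℝ) : Integrable (limitDensity c) := by
  rw [limitDensity_eq_indicator, integrable_indicator_iff measurableSet_Ioo]
  exact (Continuous.integrableOn_Icc (by fun_prop)).mono_set Set.Ioo_subset_Icc_self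

/-- The substitution `t = √c cos θ`. -/
lemma integral_limitDensity_mul {c : ℝ} (hc : 0 < c) {f : ℝ → ℝ} (hf : Continuous f) :
    ∫ t, limitDensity c t * f t =
      2 / Real.pi * ∫ θ in (0 : ℝ)..Real.pi, f (√c * Real.cos θ) * Real.sin θ ^ 2 := by
  set g : ℝ → ℝ := fun t => 2 / (Real.pi * c) * √(c - t ^ 2) * f t with hg
  have hgc : Continuous g := by fun_prop
  have h1 : ∫ t, limitDensity c t * f t = ∫ t in (-√c)..√c, g t := by
    rw [intervalIntegral.integral_of_le (by linarith [Real.sqrt_nonneg c]),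
      integral_Ioc_eq_integral_Ioo, ← integral_indicator measurableSet_Ioo]
    refine integral_congr_ae (Eventually.of_forall fun t => ?_)
    simp only [limitDensity_eq_indicator, Set.indicator_apply, hg]
    split_ifs <;> simp
  have h2 := intervalIntegral.integral_comp_mul_deriv (a := 0) (b := Real.pi)
    (f := fun θ => √c * Real.cos θ) (f' := fun θ => √c * -Real.sin θ) (g := g)
    (fun θ _ => (Real.hasDerivAt_cos θ).const_mul _) (by fun_prop) hgc
  simp only [Real.cos_zero, Real.cos_pi, mul_one, mul_neg] at h2
  rw [h1, intervalIntegral.integral_symm, ← h2, ← intervalIntegral.integral_neg,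
    ← intervalIntegral.integral_const_mul]
  refine intervalIntegral.integral_congr fun θ hθ => ?_
  rw [Set.uIcc_of_le Real.pi_pos.le] at hθ
  have hsin := Real.sin_nonneg_of_mem_Icc hθ
  have hsq : √c * √c = c := Real.mul_self_sqrt hc.le
  have h3 : √(c - (√c * Real.cos θ) ^ 2) = √c * Real.sin θ := by
    rw [mul_pow, Real.sq_sqrt hc.le, show c - c * Real.cos θ ^ 2 = (√c * Real.sin θ) ^ 2 by
      rw [mul_pow, Real.sq_sqrt hc.le, Real.sin_sq]; ring,
      Real.sqrt_sq (by positivity)]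
  simp only [hg, Function.comp_apply, h3]
  have hpi := Real.pi_ne_zero
  field_simp
  rw [Real.sq_sqrt hc.le]

/-- The moments of the limit law: by integration by parts
`∫ cos ^ (k + 2) = (k + 1) / (k + 2) * ∫ cos ^ k` over `[0, π]`. -/
lemma integral_limitDensity_mul_pow {c : ℝ} (hc : 0 < c) (k : ℕ) :
    ∫ t, limitDensity c t * t ^ k = √c ^ k * (cosCoeff k 0 / ((k : ℝ) / 2 + 1)) := by
  rw [integral_limitDensity_mul hc (by fun_prop)]
  have h1 : ∫ θ in (0 : ℝ)..Real.pi, (√c * Real.cos θ) ^ k * Real.sin θ ^ 2 =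
      √c ^ k * ((∫ θ in (0 : ℝ)..Real.pi, Real.cos θ ^ k) -
        ∫ θ in (0 : ℝ)..Real.pi, Real.cos θ ^ (k + 2)) := by
    rw [← intervalIntegral.integral_sub (Continuous.intervalIntegrable (by fun_prop) _ _)
      (Continuous.intervalIntegrable (by fun_prop) _ _), ← intervalIntegral.integral_const_mul]
    refine intervalIntegral.integral_congr fun θ _ => ?_
    simp only [Real.sin_sq]
    ring
  rw [h1, integral_cos_pow]
  simp only [cosCoeff, Int.cast_zero, zero_mul, Real.cos_zero, mul_one, Real.sin_pi, Real.sin_zero,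
    mul_zero, sub_zero, zero_div, zero_add]
  have hpi := Real.pi_ne_zero
  have hk : (k : ℝ) + 2 ≠ 0 := by positivity
  have hk' : (k : ℝ) / 2 + 1 ≠ 0 := by positivity
  field_simp
  ring

/-- The probability measure with density `limitDensity c`. -/
noncomputable def limitMeasure (c : ℝ) : Measure ℝ :=
  volume.withDensity fun t => ENNReal.ofReal (limitDensity c t)

lemma isProbabilityMeasure_limitMeasure {c : ℝ} (hc : 0 < c) :
    IsProbabilityMeasure (limitMeasure c) := by
  constructor
  have h := integral_limitDensity_mul_pow hc 0
  simp only [pow_zero, mul_one, cosCoeff_zero, if_true, Nat.cast_zero, zero_div, zero_add,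
    div_one] at h
  rw [limitMeasure, withDensity_apply _ MeasurableSet.univ, setLIntegral_univ,
    ← ofReal_integral_eq_lintegral_ofReal (integrable_limitDensity c)
      (Eventually.of_forall (limitDensity_nonneg hc)), h, ENNReal.ofReal_one]

lemma integral_limitMeasure {c : ℝ} (hc : 0 < c) (f : ℝ → ℝ) :
    ∫ t, f t ∂limitMeasure c = ∫ t, limitDensity c t * f t := by
  rw [limitMeasure, integral_withDensity_eq_integral_toReal_smul
    (measurable_limitDensity c).ennreal_ofReal
    (Eventually.of_forall fun t => ENNReal.ofReal_lt_top)]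
  refine integral_congr_ae (Eventually.of_forall fun t => ?_)
  simp [ENNReal.toReal_ofReal (limitDensity_nonneg hc t)]

lemma ae_limitMeasure_abs_le (c : ℝ) : ∀ᵐ t ∂limitMeasure c, |t| ≤ √c := by
  rw [limitMeasure, ae_withDensity_iff (measurable_limitDensity c).ennreal_ofReal]
  refine Eventually.of_forall fun t ht => ?_
  by_contra hlt
  refine ht ?_
  rw [limitDensity, if_neg, ENNReal.ofReal_zero]
  exact fun h => hlt (abs_le.2 ⟨h.1.le, h.2.le⟩)

/-! ### Convergence of moments implies weak convergence -/

/-- For probability measures living on one bounded interval, convergence of all moments implies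
weak convergence, by Weierstrass approximation. -/
lemma tendsto_integral_of_tendsto_moments {ι : Type*} {F : Filter ι} {μ : ι → Measure ℝ}
    {ν : Measure ℝ} {R : ℝ} (hμ : ∀ᶠ i in F, IsProbabilityMeasure (μ i) ∧ ∀ᵐ x ∂μ i, |x| ≤ R)
    [IsProbabilityMeasure ν] (hν : ∀ᵐ x ∂ν, |x| ≤ R)
    (hmom : ∀ k : ℕ, Tendsto (fun i => ∫ x, x ^ k ∂μ i) F (𝓝 (∫ x, x ^ k ∂ν)))
    {f : ℝ → ℝ} (hf : Continuous f) :
    Tendsto (fun i => ∫ x, f x ∂μ i) F (𝓝 (∫ x, f x ∂ν)) := by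
  have hint : ∀ (ρ : Measure ℝ) [IsProbabilityMeasure ρ], (∀ᵐ x ∂ρ, |x| ≤ R) →
      ∀ g : ℝ → ℝ, Continuous g → Integrable g ρ := by
    intro ρ _ hρ g hg
    obtain ⟨K, hK⟩ := isCompact_Icc.exists_bound_of_continuousOn (s := Set.Icc (-R) R)
      hg.continuousOn
    refine Integrable.of_bound hg.aestronglyMeasurable K ?_
    filter_upwards [hρ] with x hx using hK x (abs_le.1 hx)
  have hpoly : ∀ (ρ : Measure ℝ) [IsProbabilityMeasure ρ], (∀ᵐ x ∂ρ, |x| ≤ R) → ∀ p : ℝ[X],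
      ∫ x, p.eval x ∂ρ = ∑ k ∈ Finset.range (p.natDegree + 1), p.coeff k * ∫ x, x ^ k ∂ρ := by
    intro ρ _ hρ p
    simp only [eval_eq_sum_range]
    rw [integral_finsetSum _ fun k _ => (hint ρ hρ _ (by fun_prop))]
    simp only [integral_const_mul]
  have hp : ∀ p : ℝ[X], Tendsto (fun i => ∫ x, p.eval x ∂μ i) F (𝓝 (∫ x, p.eval x ∂ν)) := by
    intro p
    rw [hpoly ν hν]
    refine (tendsto_finsetSum _ fun k _ => (hmom k).const_mul (p.coeff k)).congr' ?_
    filter_upwards [hμ] with i hi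
    have := hi.1
    rw [hpoly _ hi.2]
  rw [Metric.tendsto_nhds]
  intro ε hε
  obtain ⟨p, hpf⟩ := exists_polynomial_near_of_continuousOn (-R) R f hf.continuousOn (ε / 3)
    (by positivity)
  have hclose : ∀ (ρ : Measure ℝ) [IsProbabilityMeasure ρ], (∀ᵐ x ∂ρ, |x| ≤ R) →
      |∫ x, p.eval x ∂ρ - ∫ x, f x ∂ρ| ≤ ε / 3 := by
    intro ρ _ hρ
    rw [← integral_sub (hint ρ hρ _ p.continuous) (hint ρ hρ _ hf)]
    have := norm_integral_le_of_norm_le_const (μ := ρ) (f := fun x => p.eval x - f x) (C := ε / 3)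
      (by filter_upwards [hρ] with x hx using (hpf x (abs_le.1 hx)).le)
    simpa using this
  filter_upwards [hμ, Metric.tendsto_nhds.1 (hp p) (ε / 3) (by positivity)] with i hi hpi
  have := hi.1
  have h1 := abs_le.1 (hclose (μ i) hi.2)
  have h2 := abs_le.1 (hclose ν hν)
  rw [Real.dist_eq, abs_lt] at hpi ⊢
  constructor <;> linarith [h1.1, h1.2, h2.1, h2.2, hpi.1, hpi.2]

/-! ### Zero counting measures -/

lemma integral_sum_pointMass (s : Multiset ℝ) (f : ℝ → ℝ) :
    Integrable f ((s.map pointMass).sum : FiniteMeasure ℝ) ∧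
      ∫ x, f x ∂((s.map pointMass).sum : FiniteMeasure ℝ) = (s.map f).sum := by
  induction s using Multiset.induction_on with
  | empty => simp
  | cons a s ih =>
    have ha : Integrable f (pointMass a : Measure ℝ) := integrable_dirac (by simp)
    rw [Multiset.map_cons, Multiset.sum_cons, FiniteMeasure.toMeasure_add, Multiset.map_cons,
      Multiset.sum_cons, integral_add_measure ha ih.1, ih.2]
    exact ⟨ha.add_measure ih.1, congrArg (· + _) (integral_dirac f a)⟩

lemma integral_zeroCountingMeasure (p : ℝ[X]) (f : ℝ → ℝ) :
    ∫ x, f x ∂(zeroCountingMeasure p : Measure ℝ) = (p.natDegree : ℝ)⁻¹ * (p.roots.map f).sum := by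
  rw [zeroCountingMeasure, FiniteMeasure.toMeasure_smul, integral_smul_nnreal_measure,
    (integral_sum_pointMass _ f).2, NNReal.smul_def]
  simp

lemma ae_zeroCountingMeasure {p : ℝ[X]} {P : ℝ → Prop} (h : ∀ x ∈ p.roots, P x) :
    ∀ᵐ x ∂(zeroCountingMeasure p : Measure ℝ), P x := by
  rw [zeroCountingMeasure, FiniteMeasure.toMeasure_smul]
  refine Measure.ae_smul_measure ?_ _
  generalize p.roots = s at h
  induction s using Multiset.induction_on with
  | empty => simp
  | cons a s ih =>
    rw [Multiset.map_cons, Multiset.sum_cons, FiniteMeasure.toMeasure_add, ae_add_measure_iff]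
    refine ⟨?_, ih fun x hx => h x (Multiset.mem_cons_of_mem hx)⟩
    change ∀ᵐ x ∂Measure.dirac a, P x
    rw [ae_dirac_eq]
    exact h a (Multiset.mem_cons_self a s)

lemma isProbabilityMeasure_zeroCountingMeasure {p : ℝ[X]} (h0 : p.natDegree ≠ 0)
    (h : Multiset.card p.roots = p.natDegree) :
    IsProbabilityMeasure (zeroCountingMeasure p : Measure ℝ) := by
  have h1 := integral_zeroCountingMeasure p fun _ => 1
  rw [integral_const, smul_eq_mul, mul_one] at h1
  rw [isProbabilityMeasure_iff_real, h1]
  simp [h, h0]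

/-! ### Zeros of rescaled orthonormal polynomials -/

namespace IsJacobiRecurrence

variable {b : ℕ → ℝ} {p : ℕ → ℝ[X]}

lemma natDegree_comp (h : IsJacobiRecurrence b p) (n : ℕ) {a : ℝ} (ha : a ≠ 0) :
    ((p n).comp (C a * X)).natDegree = n := by
  rw [Polynomial.natDegree_comp, h.natDegree_eq, natDegree_C_mul_X a ha, mul_one]

lemma roots_comp (h : IsJacobiRecurrence b p) (n : ℕ) {a : ℝ} (ha : a ≠ 0) :
    ((p n).comp (C a * X)).roots =
      Finset.univ.val.map fun i => (jacobiMatrix_isHermitian b n).eigenvalues i / a := by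
  have e := roots_comp_C_mul_X_add_C (p n) a 0 ha.isUnit
  rw [C_0, add_zero] at e
  rw [e, h.roots_eq, Multiset.map_map]
  refine Multiset.map_congr rfl fun i _ => ?_
  rw [Function.comp_apply, sub_zero, Ring.inverse_eq_inv', div_eq_inv_mul]

/-- The rescaled zeros have the moments `tr (J_n / √m) ^ k / n`, which converge to those of the
limit law; they also stay bounded because `‖J_n‖` is of order `√n`. -/
lemma tendsto_integral_zeroCountingMeasure (h : IsJacobiRecurrence b p)
    (hb : Tendsto (fun n : ℕ => b n / √n) atTop (𝓝 (1 / 2))) {c : ℝ} (hc : 0 < c)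
    {ι : Type*} {F : Filter ι} {n : ι → ℕ} {m : ι → ℝ} (hn : Tendsto n F atTop)
    (hm : Tendsto (fun i => (n i : ℝ) / m i) F (𝓝 c)) {f : ℝ → ℝ} (hf : Continuous f) :
    Tendsto (fun i => ∫ x, f x ∂(zeroCountingMeasure ((p (n i)).comp (C √(m i) * X)) : Measure ℝ))
      F (𝓝 (∫ x, f x ∂limitMeasure c)) := by
  obtain ⟨M, hM⟩ : ∃ M : ℝ, ∀ i : ℕ, b i ≤ M * √i := by
    obtain ⟨M, hM⟩ := hb.bddAbove_range
    refine ⟨M, fun i => ?_⟩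
    rcases Nat.eq_zero_or_pos i with rfl | hi
    · simp [h.zero_coeff]
    · rw [← div_le_iff₀ (Real.sqrt_pos.2 (by exact_mod_cast hi))]
      exact hM ⟨i, rfl⟩
  have hM0 : 0 ≤ M := by simpa using (h.nonneg 1).trans (hM 1)
  have hev : ∀ᶠ i in F, 0 < n i ∧ 0 < m i ∧ (n i : ℝ) / m i ≤ 2 * c := by
    filter_upwards [hn.eventually_gt_atTop 0, hm.eventually (eventually_gt_nhds hc),
      hm.eventually (eventually_le_nhds (by linarith : c < 2 * c))] with i h1 h2 h3
    refine ⟨h1, ?_, h3⟩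
    by_contra hle
    exact h2.not_ge (div_nonpos_of_nonneg_of_nonpos (Nat.cast_nonneg _) (not_lt.1 hle))
  have := isProbabilityMeasure_limitMeasure hc
  refine tendsto_integral_of_tendsto_moments (R := max √c (2 * M * √(2 * c))) ?_ ?_ ?_ hf
  · filter_upwards [hev] with i ⟨h1, h2, h3⟩
    have hs : 0 < √(m i) := Real.sqrt_pos.2 h2
    refine ⟨isProbabilityMeasure_zeroCountingMeasure ?_ ?_, ae_zeroCountingMeasure fun x hx => ?_⟩
    · rw [h.natDegree_comp _ hs.ne']; exact h1.ne'
    · rw [h.natDegree_comp _ hs.ne', h.roots_comp _ hs.ne']; simp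
    · rw [h.roots_comp _ hs.ne'] at hx
      obtain ⟨j, -, rfl⟩ := Multiset.mem_map.1 hx
      refine le_trans ?_ (le_max_right _ _)
      have hbound := abs_eigenvalue_jacobiMatrix_le h.zero_coeff h.nonneg (B := M * √(n i))
        (fun l hl => (hM l).trans (by gcongr))
        ((jacobiMatrix_isHermitian b (n i)).eigenvectorBasis_ne_zero j)
        ((jacobiMatrix_isHermitian b (n i)).mulVec_eigenvectorBasis j)
      rw [abs_div, abs_of_pos hs, div_le_iff₀ hs, mul_assoc (2 * M),
        ← Real.sqrt_mul (by positivity),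
        mul_assoc]
      refine hbound.trans ?_
      have := (div_le_iff₀ h2).1 h3
      gcongr
  · filter_upwards [ae_limitMeasure_abs_le c] with x hx using hx.trans (le_max_left _ _)
  · intro k
    rw [integral_limitMeasure hc, integral_limitDensity_mul_pow hc]
    have h1 := (tendsto_trace_jacobiMatrix_pow h.zero_coeff h.nonneg hM hb k).comp hn
    have h2 := ((Real.continuous_sqrt.tendsto c).comp hm).pow k
    refine (h2.mul h1).congr' ?_
    filter_upwards [hev] with i ⟨hn0, hm0, _⟩
    have hs : 0 < √(m i) := Real.sqrt_pos.2 hm0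
    have hn0' : (0 : ℝ) < n i := by exact_mod_cast hn0
    have hsn : 0 < √(n i : ℝ) := Real.sqrt_pos.2 hn0'
    rw [integral_zeroCountingMeasure, h.natDegree_comp _ hs.ne', h.roots_comp _ hs.ne',
      Multiset.map_map]
    change _ = _ * ∑ j, ((jacobiMatrix_isHermitian b (n i)).eigenvalues j / √(m i)) ^ k
    simp only [Function.comp_apply, div_pow, Real.sqrt_div hn0'.le]
    rw [← Finset.sum_div, ← (jacobiMatrix_isHermitian b (n i)).trace_pow_eq_sum]
    field_simp

end IsJacobiRecurrence

/-! ### The polynomials `φ_n` -/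

/-- The off-diagonal recurrence coefficients `√(λ_n / 2)` of `phi`, with the value `0` at
`n = 0`. -/
noncomputable def phiCoeff (α β : ℝ) (n : ℕ) : ℝ :=
  if n = 0 then 0 else √(recLambda α β n / 2)

lemma recLambda_succ_pos {α β : ℝ} (hα : 0 ≤ α) (hαβ : α < β) (n : ℕ) :
    0 < recLambda α β (n + 1) := by
  have hn : (0 : ℝ) ≤ n := Nat.cast_nonneg n
  unfold recLambda
  push_cast
  refine div_pos (mul_pos ?_ ?_) ?_ <;> linarith

lemma isJacobiRecurrence_phi {α β : ℝ} (hα : 0 ≤ α) (hαβ : α < β) :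
    IsJacobiRecurrence (phiCoeff α β) (phi α β) := by
  have hpos : ∀ i, 0 < phiCoeff α β (i + 1) := fun i => by
    rw [phiCoeff, if_neg (Nat.succ_ne_zero i)]
    exact Real.sqrt_pos.2 (half_pos (recLambda_succ_pos hα hαβ i))
  have hinv : ∀ i, phiCoeff α β (i + 1) * √(2 / recLambda α β (i + 1)) = 1 := fun i => by
    have := recLambda_succ_pos hα hαβ i
    rw [phiCoeff, if_neg (Nat.succ_ne_zero i), ← Real.sqrt_mul (by positivity),
      div_mul_div_cancel₀ two_ne_zero, div_self this.ne', Real.sqrt_one]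
  refine ⟨if_pos rfl, hpos, rfl, fun n => ?_⟩
  cases n with
  | zero =>
    rw [phi, phi, ← mul_assoc, ← C_mul, hinv 0]
    simp [phiCoeff]
  | succ n =>
    rw [phi, ← mul_assoc, ← C_mul, hinv (n + 1)]
    simp [phiCoeff]

lemma tendsto_phiCoeff (α β : ℝ) :
    Tendsto (fun n : ℕ => phiCoeff α β n / √n) atTop (𝓝 (1 / 2)) := by
  have hd : ∀ a : ℝ, Tendsto (fun n : ℕ => 1 + a / (n : ℝ)) atTop (𝓝 1) := fun a => by
    simpa using (tendsto_const_div_atTop_nhds_zero_nat a).const_add 1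
  have h1 : Tendsto (fun n : ℕ => (1 + (β + α - 1) / (n : ℝ)) * (1 + (β - α - 1) / (n : ℝ)) /
      (4 * (1 + (β - 1 / 2) / (n : ℝ)))) atTop (𝓝 (1 / 4)) := by
    rw [show (1 / 4 : ℝ) = 1 * 1 / (4 * 1) by norm_num]
    exact ((hd (β + α - 1)).mul (hd (β - α - 1))).div ((hd (β - 1 / 2)).const_mul 4) (by norm_num)
  have h2 := (Real.continuous_sqrt.tendsto _).comp h1
  rw [show √(1 / 4 : ℝ) = 1 / 2 by
    rw [show (1 / 4 : ℝ) = (1 / 2) ^ 2 by norm_num, Real.sqrt_sq (by norm_num)]] at h2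
  refine h2.congr' ?_
  filter_upwards [eventually_gt_atTop 0] with n hn
  have hn' : (n : ℝ) ≠ 0 := by exact_mod_cast hn.ne'
  rw [Function.comp_apply, phiCoeff, if_neg hn.ne', ← Real.sqrt_div' _ (Nat.cast_nonneg n),
    recLambda]
  congr 1
  have e : ∀ a : ℝ, 1 + a / (n : ℝ) = (n + a) / n := fun a => by field_simp
  simp only [e]
  rw [show (n : ℝ) + (β + α - 1) = n + β + α - 1 by ring,
    show (n : ℝ) + (β - α - 1) = n + β - α - 1 by ring,
    show (n : ℝ) + (β - 1 / 2) = n + β - 1 / 2 by ring]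
  -- the denominator may vanish for one `n`, where both sides have the junk value `0`
  generalize (n : ℝ) + β - 1 / 2 = d
  rcases eq_or_ne d 0 with rfl | hd0
  · simp
  · field_simp
    norm_num

theorem mainTheorem2 (c : ℝ) (hc : 0 < c) :
    ∃ ν : ProbabilityMeasure ℝ,
      (ν : Measure ℝ) = volume.withDensity (fun t => ENNReal.ofReal (limitDensity c t)) ∧
      ∀ α β : ℝ, 0 ≤ α → α < β →
        (∀ (n : ℕ) (m : ℝ), 0 < m →
          (rescaledPhi α β n m).natDegree = n ∧
          Multiset.card (rescaledPhi α β n m).roots = n) ∧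
        Filter.Tendsto
          (fun q : ℕ × ℝ => zeroCountingMeasure (rescaledPhi α β q.1 q.2))
          (Filter.comap (fun q : ℕ × ℝ => q.1) Filter.atTop ⊓
            Filter.comap (fun q : ℕ × ℝ => (q.1 : ℝ) / q.2) (nhds c))
          (nhds ν.toFiniteMeasure) := by
  refine ⟨⟨limitMeasure c, isProbabilityMeasure_limitMeasure hc⟩, rfl, fun α β hα hαβ => ?_⟩
  have h := isJacobiRecurrence_phi hα hαβ
  refine ⟨fun n m hm => ?_, ?_⟩
  · have hs : √m ≠ 0 := (Real.sqrt_pos.2 hm).ne'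
    refine ⟨h.natDegree_comp n hs, ?_⟩
    rw [rescaledPhi, h.roots_comp n hs]
    simp
  · rw [FiniteMeasure.tendsto_iff_forall_integral_tendsto]
    intro f
    exact h.tendsto_integral_zeroCountingMeasure (tendsto_phiCoeff α β) hc
      (tendsto_comap.mono_left inf_le_left) (tendsto_comap.mono_left inf_le_right) f.continuous
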